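/- A finite quiver $Q$ is identified with its adjacency matrix $(q_{ij})$ over $\mathbb{N}$, where $q_{ij}$ is the number of arrows from $i$ to $j$; its spectral radius $\rho(Q)$ is the spectral radius of this matrix, and $Q^{op}$ is the quiver with the transposed matrix. An automorphism of $Q$ is a permutation $\sigma$ of the vertices with $q_{\sigma(i)\sigma(j)}=q_{ij}$ for all $i,j$, and the twist ${}^{\sigma}Q$ is the quiver with $({}^{\sigma}Q)_{ij}=q_{\sigma(i)j}$. A graph is a quiver $G$ with $G^{op}=G$. A quiver $Q$ is a pretzelization of a graph $G$ if the disjoint union $Q\cup Q$ is isomorphic to ${}^{\tau}H$, where $H$ is a disjoint union of finitely many copies of $G$ and $\tau$ is an automorphism of $H$. The graphs of $\widetilde{A}\widetilde{D}\widetilde{E}$ type are the following, up to isomorphism; the first four have vertices $0,\dots,n$, an edge between $i\ne j$ contributes $1$ to both $q_{ij}$ and $q_{ji}$, and a loop at $i$ contributes $1$ to $q_{ii}$. - $\widetilde{A}_n$ ($n\ge 1$): the cycle with $n+1$ vertices (for $n=1$: two vertices joined by two edges). - $\widetilde{D}_n$ ($n\ge 4$): the path $1,2,\dots,n-1$, with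 $0$ joined to $2$ and $n$ joined to $n-2$. - $\widetilde{L}_n$ ($n\ge 0$): the path $0,1,\dots,n$ with one loop added at each end (for $n=0$: one vertex with two loops). - $\widetilde{DL}_n$ ($n\ge 2$): the path $1,2,\dots,n$, with $0$ joined to $2$ and a loop at $n$. - $\widetilde{E}_6,\widetilde{E}_7,\widetilde{E}_8$: the trees with one vertex of degree three from which three paths with $(2,2,2)$, $(1,3,3)$, $(1,2,5)$ edges, respectively, issue. **Proposition 2.7.** Let $Q$ be a finite connected quiver (i.e. its underlying undirected graph is connected) such that $Q^{op}={}^{\sigma}Q$ for some automorphism $\sigma$ of $Q$. If $\rho(Q)=2$, then $Q$ is a pretzelization of a graph of $\widetilde{A}\widetilde{D}\widetilde{E}$ type. -/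

import Mathlib

namespace Pretzel

/-- A finite quiver with vertex set `V`, given by its adjacency matrix:
`Q i j` is the number of arrows from `i` to `j`. -/
abbrev FinQuiver (V : Type*) := Matrix V V ℕ

/-- The opposite quiver: every arrow is reversed. -/
def FinQuiver.op {V : Type*} (Q : FinQuiver V) : FinQuiver V := fun i j => Q j i

/-- A graph is a symmetric quiver. -/
def FinQuiver.IsGraph {V : Type*} (Q : FinQuiver V) : Prop := Q.op = Q

/-- The permutation `σ` of the vertices is an automorphism of `Q`. -/
def FinQuiver.IsAut {V : Type*} (Q : FinQuiver V) (σ : Equiv.Perm V) : Prop :=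
  ∀ i j, Q (σ i) (σ j) = Q i j

/-- The twist of `Q` by `σ`, with entries `Q (σ i) j`. -/
def FinQuiver.twist {V : Type*} (Q : FinQuiver V) (σ : Equiv.Perm V) : FinQuiver V :=
  fun i j => Q (σ i) j

/-- Isomorphism of quivers: relabelling of the vertices. -/
def FinQuiver.Iso {V W : Type*} (Q : FinQuiver V) (R : FinQuiver W) : Prop :=
  ∃ e : V ≃ W, ∀ i j, R (e i) (e j) = Q i j

/-- The disjoint union of two quivers. -/
def FinQuiver.union {V W : Type*} (Q : FinQuiver V) (R : FinQuiver W) : FinQuiver (V ⊕ W) :=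
  Matrix.fromBlocks Q 0 0 R

/-- The disjoint union of `k` copies of a quiver. -/
def FinQuiver.copies {V : Type*} (Q : FinQuiver V) (k : ℕ) : FinQuiver (V × Fin k) :=
  Matrix.blockDiagonal fun _ : Fin k => Q

/-- The quiver is connected: its underlying undirected graph is connected. -/
def FinQuiver.IsConnected {V : Type*} (Q : FinQuiver V) : Prop :=
  (SimpleGraph.fromRel fun i j => Q i j ≠ 0).Connected

/-- The spectral radius of the adjacency matrix, over the complex numbers. -/
noncomputable def FinQuiver.specRadius {V : Type*} [Fintype V] [DecidableEq V]
    (Q : FinQuiver V) : ENNReal :=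
  spectralRadius ℂ (Matrix.map Q (fun q : ℕ => (q : ℂ)))

/-- `Q` is a pretzelization of the graph `G`: the quiver `Q ∪ Q` is (isomorphic to) a twist
of a disjoint union of finitely many copies of `G`. -/
def FinQuiver.IsPretzelizationOf {V W : Type*} (Q : FinQuiver V) (G : FinQuiver W) : Prop :=
  G.IsGraph ∧ ∃ (k : ℕ) (τ : Equiv.Perm (W × Fin k)),
    (G.copies k).IsAut τ ∧ (Q.union Q).Iso ((G.copies k).twist τ)

/-- The graph on `{0, …, n}` with one edge between `i` and `j` (a loop, if `i = j`)
whenever `r i j` or `r j i` holds. -/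
def graphOfRel (n : ℕ) (r : ℕ → ℕ → Prop) [DecidableRel r] : FinQuiver (Fin (n + 1)) :=
  fun i j => if r i j ∨ r j i then 1 else 0

/-- The cycle with `n + 1` vertices, used for `1 ≤ n`; for `n = 1` it has two vertices joined by
two edges. -/
def tildeA (n : ℕ) : FinQuiver (Fin (n + 1)) :=
  fun i j => (if j = i + 1 then 1 else 0) + (if i = j + 1 then 1 else 0)

/-- For `4 ≤ n`: the path `1, 2, …, n - 1`, with a further vertex `0` joined to `2` and a further
vertex `n` joined to `n - 2`. -/
def tildeD (n : ℕ) : FinQuiver (Fin (n + 1)) :=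
  graphOfRel n fun i j =>
    (i = 0 ∧ j = 2) ∨ (1 ≤ i ∧ j = i + 1 ∧ j + 1 ≤ n) ∨ (i + 2 = n ∧ j = n)

/-- The path `0, 1, …, n` with one loop added at each of its two ends; for `n = 0` this is one
vertex with two loops. -/
def tildeL (n : ℕ) : FinQuiver (Fin (n + 1)) :=
  fun i j => graphOfRel n (fun a b => b = a + 1) i j
    + (if i = 0 ∧ j = 0 then 1 else 0) + (if i = Fin.last n ∧ j = Fin.last n then 1 else 0)

/-- For `2 ≤ n`: the path `1, 2, …, n`, with a further vertex `0` joined to `2` and a loop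
at `n`. -/
def tildeDL (n : ℕ) : FinQuiver (Fin (n + 1)) :=
  graphOfRel n fun i j =>
    (i = 0 ∧ j = 2) ∨ (1 ≤ i ∧ j = i + 1) ∨ (i = n ∧ j = n)

/-- The path `0, 1, 2, 3, 4` with a second path `2, 5, 6` attached at its middle vertex. -/
def tildeE6 : FinQuiver (Fin 7) :=
  graphOfRel 6 fun i j => (j = i + 1 ∧ j ≤ 4) ∨ (i = 2 ∧ j = 5) ∨ (i = 5 ∧ j = 6)

/-- The path `0, 1, …, 6` with a vertex `7` joined to `3`. -/
def tildeE7 : FinQuiver (Fin 8) :=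
  graphOfRel 7 fun i j => (j = i + 1 ∧ j ≤ 6) ∨ (i = 3 ∧ j = 7)

/-- The path `0, 1, …, 7` with a vertex `8` joined to `2`. -/
def tildeE8 : FinQuiver (Fin 9) :=
  graphOfRel 8 fun i j => (j = i + 1 ∧ j ≤ 7) ∨ (i = 2 ∧ j = 8)

/-- The graphs of extended ADE type, up to isomorphism. -/
def FinQuiver.IsTildeADE {W : Type*} (G : FinQuiver W) : Prop :=
  (∃ n, 1 ≤ n ∧ G.Iso (tildeA n)) ∨
  (∃ n, 4 ≤ n ∧ G.Iso (tildeD n)) ∨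
  (∃ n, G.Iso (tildeL n)) ∨
  (∃ n, 2 ≤ n ∧ G.Iso (tildeDL n)) ∨
  G.Iso tildeE6 ∨ G.Iso tildeE7 ∨ G.Iso tildeE8

end Pretzel

/-! Pass to the bipartite double cover `B` of `Q`, the graph on `V ⊕ V` with blocks `0, Q, Qᵀ, 0`.
From `Q.op = Q.twist σ` one gets an automorphism `swapVia σ` of `B` exchanging the two copies of
`V`, and `Q ∪ Q` is the twist of `B` by its inverse (`union_swapVia`, `doubleCover_swapVia`). It
remains to show that `B` is a disjoint union of copies of one extended ADE graph.

The same relation makes `Q` a normal matrix, so its operator norm is its spectral radius 2. This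
forces `Q` and its transpose to share a nonnegative eigenvector `w` for the eigenvalue 2
(`exists_common_perron`). Connectedness makes `w` positive, and `(w, w)` is a positive vector on `B`
whose neighbour sums are twice its values (`isHarmonic_doubleCover`).

Such a vector is rigid: an extended ADE graph embedded in `B` also has a positive null vector, and
pairing the two leaves no room for further arrows, so the embedded graph is a whole component
(`isChart_of_isNullVector`). It therefore suffices to find one such graph inside `B`
(`hasTildeADEChart`). A cycle or double edge gives type A. Otherwise `B` is a forest; it has a
branch vertex, and a fourth neighbour or a second branch vertex gives type D. What is left is a star
with three arms ending at leaves, whose lengths must solve the unit fraction equation of type E. As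
`B` has no loops, types L and DL do not arise here.

Finally, connectedness of `Q` and the automorphism carry this component onto every point of `B`
(`exists_chart_through`), so `B` consists of copies of it (`exists_equiv_copies`). -/

namespace Pretzel

open Finset

/-! ### Embedded graphs with a null vector are whole components -/

section Charts

variable {X W : Type*}

/-- `H` maps injectively into `B`, its arrows being among those of `B`. -/
def Embeds (H : FinQuiver W) (B : FinQuiver X) : Prop :=
  ∃ f : W → X, Function.Injective f ∧ ∀ a b, H a b ≤ B (f a) (f b)

/-- `f` identifies `H` with a full subquiver of `B` which no arrow of `B` leaves. -/
structure IsChart (H : FinQuiver W) (B : FinQuiver X) (f : W → X) : Prop where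
  injective : Function.Injective f
  map_eq : ∀ a b, B (f a) (f b) = H a b
  closed : ∀ a y, B (f a) y ≠ 0 → y ∈ Set.range f

/-- A positive integral null vector of the generalized Cartan matrix `2 - H`. -/
def IsNullVector [Fintype W] (H : FinQuiver W) (δ : W → ℕ) : Prop :=
  (∀ a, 0 < δ a) ∧ ∀ a, ∑ b, H a b * δ b = 2 * δ a

/-- `u` is a positive real null vector of `2 - B`. -/
def IsHarmonic [Fintype X] (B : FinQuiver X) (u : X → ℝ) : Prop :=
  (∀ x, 0 < u x) ∧ ∀ x, ∑ y, (B x y : ℝ) * u y = 2 * u x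

/-- Pair `δ` with `2 - B` and with `2 - H` applied to `u`: both vanish, so the excess of `B` over
the image of `H`, weighted by positive numbers, sums to zero. Being nonnegative, it vanishes
entrywise. -/
theorem isChart_of_isNullVector [Fintype X] [Fintype W] {B : FinQuiver X} {u : X → ℝ}
    (hu : IsHarmonic B u) {H : FinQuiver W} (hH : H.IsGraph) {δ : W → ℕ}
    (hδ : IsNullVector H δ) {f : W → X} (hf : Function.Injective f)
    (hle : ∀ a b, H a b ≤ B (f a) (f b)) : IsChart H B f := by
  classical
  have hsymm : ∀ a b, H a b = H b a := fun a b => congrFun (congrFun hH b) a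
  -- `K` is `H` transported along `f` in its second index and extended by zero.
  let K : W → X → ℝ := fun a y => ∑ b, if f b = y then (H a b : ℝ) else 0
  have hK : ∀ a b, K a (f b) = H a b := by
    intro a b
    simp [K, hf.eq_iff]
  have hK0 : ∀ a y, y ∉ Set.range f → K a y = 0 := by
    intro a y hy
    refine Finset.sum_eq_zero fun b _ => if_neg fun h => hy ⟨b, h⟩
  have hKle : ∀ a y, K a y ≤ B (f a) y := by
    intro a y
    by_cases hy : y ∈ Set.range f
    · obtain ⟨b, rfl⟩ := hy
      rw [hK]
      exact_mod_cast hle a b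
    · rw [hK0 a y hy]
      positivity
  have hKu : ∀ a, ∑ y, K a y * u y = ∑ b, (H a b : ℝ) * u (f b) := by
    intro a
    simp only [K, Finset.sum_mul]
    rw [Finset.sum_comm]
    refine Finset.sum_congr rfl fun b _ => ?_
    simp
  have h1 : ∑ a, (δ a : ℝ) * ∑ y, ((B (f a) y : ℝ) - K a y) * u y = 0 := by
    have e : ∀ a, (δ a : ℝ) * ∑ y, ((B (f a) y : ℝ) - K a y) * u y
        = 2 * δ a * u (f a) - ∑ b, (δ a : ℝ) * (H a b) * u (f b) := by
      intro a
      simp only [sub_mul, Finset.sum_sub_distrib]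
      rw [hu.2, hKu, mul_sub, Finset.mul_sum]
      simp only [mul_assoc]
      ring
    simp only [e, Finset.sum_sub_distrib]
    rw [Finset.sum_comm (f := fun a b => (δ a : ℝ) * (H a b) * u (f b)), ← Finset.sum_sub_distrib]
    refine Finset.sum_eq_zero fun a _ => ?_
    rw [← Finset.sum_mul]
    have : (∑ b, (δ b : ℝ) * (H b a : ℝ)) = 2 * δ a := by
      have := hδ.2 a
      rw [← Nat.cast_inj (R := ℝ)] at this
      push_cast at this
      rw [← this]
      refine Finset.sum_congr rfl fun b _ => ?_
      rw [hsymm b a, mul_comm]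
    rw [this]
    ring
  have hnn : ∀ a y, 0 ≤ ((B (f a) y : ℝ) - K a y) * u y := fun a y =>
    mul_nonneg (sub_nonneg.2 (hKle a y)) (hu.1 y).le
  have h2 : ∀ a y, (B (f a) y : ℝ) = K a y := by
    intro a y
    have h3 := (Finset.sum_eq_zero_iff_of_nonneg (fun a _ =>
      mul_nonneg (Nat.cast_nonneg _) (Finset.sum_nonneg fun y _ => hnn a y))).1 h1 a
        (Finset.mem_univ _)
    have h4 := (mul_eq_zero.1 h3).resolve_left (by exact_mod_cast (hδ.1 a).ne')
    have h5 := (Finset.sum_eq_zero_iff_of_nonneg (fun y _ => hnn a y)).1 h4 y (Finset.mem_univ _)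
    exact sub_eq_zero.1 ((mul_eq_zero.1 h5).resolve_right (hu.1 y).ne')
  refine ⟨hf, fun a b => ?_, fun a y hy => ?_⟩
  · have := h2 a (f b)
    rw [hK] at this
    exact_mod_cast this
  · by_contra h
    have := h2 a y
    rw [hK0 a y h] at this
    exact hy (by exact_mod_cast this)

end Charts

/-! ### The null vectors of types A, D and E -/

section NullVectors

theorem graphOfRel_isGraph (n : ℕ) (r : ℕ → ℕ → Prop) [DecidableRel r] :
    (graphOfRel n r).IsGraph := by
  funext i j
  simp only [FinQuiver.op, graphOfRel, or_comm]

theorem tildeA_isGraph (n : ℕ) : (tildeA n).IsGraph := by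
  funext i j
  simp only [FinQuiver.op, tildeA, add_comm]

theorem tildeA_isNullVector (n : ℕ) : IsNullVector (tildeA n) fun _ => 1 := by
  refine ⟨fun _ => one_pos, fun a => ?_⟩
  have h : ∀ b : Fin (n + 1), a = b + 1 ↔ b = a - 1 := fun b =>
    ⟨fun h => by simp [h], fun h => by simp [h]⟩
  simp [tildeA, Finset.sum_add_distrib, h]

theorem graphOfRel_sum (n : ℕ) (r : ℕ → ℕ → Prop) [DecidableRel r] (δ : ℕ → ℕ)
    (a : Fin (n + 1)) (s : Finset ℕ) (hs : ∀ b, b ∈ s ↔ b ≤ n ∧ (r a b ∨ r b a)) :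
    ∑ b : Fin (n + 1), graphOfRel n r a b * δ b = ∑ b ∈ s, δ b := by
  have : s = (Finset.range (n + 1)).filter fun b => r a b ∨ r b a := by
    ext b
    simp [hs]
  rw [this, Finset.sum_filter, ← Fin.sum_univ_eq_sum_range
    (fun b => if r a b ∨ r b a then δ b else 0)]
  refine Finset.sum_congr rfl fun b _ => ?_
  simp [graphOfRel]

theorem tildeD_isNullVector (k : ℕ) :
    IsNullVector (tildeD (k + 4)) fun a => if 2 ≤ a.1 ∧ a.1 ≤ k + 2 then 2 else 1 := by
  refine ⟨fun a => by dsimp only; split_ifs <;> norm_num, fun a => ?_⟩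
  have key := graphOfRel_sum (k + 4) (fun i j =>
    (i = 0 ∧ j = 2) ∨ (1 ≤ i ∧ j = i + 1 ∧ j + 1 ≤ k + 4) ∨ (i + 2 = k + 4 ∧ j = k + 4))
    (fun a => if 2 ≤ a ∧ a ≤ k + 2 then 2 else 1) a
  have ha := a.2
  simp only [tildeD]
  by_cases h0 : a.1 ≤ 1
  · rw [key {2} (by intro b; simp only [mem_singleton]; omega)]
    simp
    omega
  by_cases h1 : k + 3 ≤ a.1
  · rw [key {k + 2} (by intro b; simp only [mem_singleton]; omega)]
    simp
    omega
  rw [if_pos (show 2 ≤ a.1 ∧ a.1 ≤ k + 2 by omega)]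
  by_cases h2 : a.1 = 2
  -- For `k = 0` the two forks share their centre, which then has four leaves.
  · rcases Nat.eq_zero_or_pos k with rfl | hk
    · rw [key {0, 1, 3, 4} (by
        intro b; simp only [mem_singleton, mem_insert]; omega)]
      simp
    · rw [key {0, 1, 3} (by intro b; simp only [mem_singleton, mem_insert]; omega)]
      simp [show 1 ≤ k by omega]
  by_cases h3 : a.1 = k + 2
  · rw [key {k + 1, k + 3, k + 4} (by intro b; simp only [mem_singleton, mem_insert]; omega)]
    simp [show 1 ≤ k by omega]
  · rw [key {a.1 - 1, a.1 + 1} (by intro b; simp only [mem_singleton, mem_insert]; omega),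
      Finset.sum_pair (by omega), if_pos (by omega), if_pos (by omega)]

theorem tildeE6_isNullVector : IsNullVector tildeE6 ![1, 2, 3, 2, 1, 2, 1] := by
  unfold IsNullVector; decide

theorem tildeE7_isNullVector : IsNullVector tildeE7 ![1, 2, 3, 4, 3, 2, 1, 2] := by
  unfold IsNullVector; decide

theorem tildeE8_isNullVector : IsNullVector tildeE8 ![2, 4, 6, 5, 4, 3, 2, 1, 3] := by
  unfold IsNullVector; decide

end NullVectors

/-! ### Walks and arms in a forest -/

section Sequences

variable {X : Type*} {B : FinQuiver X}

/-- The first `k` steps of `x` form a walk in `B` which never turns back. -/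
structure IsNonbacktracking (B : FinQuiver X) (x : ℕ → X) (k : ℕ) : Prop where
  adj : ∀ i < k, B (x i) (x (i + 1)) ≠ 0
  ne : ∀ i, i + 2 ≤ k → x (i + 2) ≠ x i

/-- A graph without loops, multiple edges and cycles. -/
structure IsForest (B : FinQuiver X) : Prop where
  symm : ∀ i j, B i j = B j i
  loopless : ∀ i, B i i = 0
  acyclic : ∀ n, 1 ≤ n → ¬ Embeds (tildeA n) B

theorem IsForest.le_one (hB : IsForest B) (i j : X) : B i j ≤ 1 := by
  by_contra! h
  have hij : i ≠ j := by
    rintro rfl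
    rw [hB.loopless] at h
    omega
  refine hB.acyclic 1 le_rfl ⟨![i, j], ?_, ?_⟩
  · intro a b
    fin_cases a <;> fin_cases b <;> simp [hij, hij.symm]
  · have h' := hB.symm i j
    intro a b
    fin_cases a <;> fin_cases b <;> simp [tildeA, hB.loopless] <;> omega

theorem IsForest.eq_one (hB : IsForest B) {i j : X} (h : B i j ≠ 0) : B i j = 1 :=
  le_antisymm (hB.le_one i j) (Nat.one_le_iff_ne_zero.2 h)

theorem IsForest.ne (hB : IsForest B) {i j : X} (h : B i j ≠ 0) : i ≠ j := by
  rintro rfl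
  exact h (hB.loopless i)

theorem IsForest.adj_comm (hB : IsForest B) {i j : X} : B i j ≠ 0 ↔ B j i ≠ 0 := by
  rw [hB.symm]

/-- A shortest return along the walk would close up to a cycle: length one is a loop, length two is
a turn back, and longer ones embed some `tildeA`. -/
theorem IsNonbacktracking.ne_of_lt (hB : IsForest B) {x : ℕ → X} {k : ℕ}
    (hx : IsNonbacktracking B x k) :
    ∀ d i, i + (d + 1) ≤ k → x (i + (d + 1)) ≠ x i := by
  intro d
  induction d using Nat.strong_induction_on with
  | _ d ih =>
    intro i hi h
    rcases d with _ | _ | d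
    · exact hB.ne (hx.adj i (by omega)) h.symm
    · exact hx.ne i hi h
    · have hinj : ∀ a b : ℕ, a < b → b ≤ d + 2 → x (i + a) ≠ x (i + b) := by
        intro a b hab hb
        obtain ⟨e, rfl⟩ := Nat.exists_eq_add_of_lt hab
        have := ih e (by omega) (i + a) (by omega)
        rw [add_assoc a e 1, ← add_assoc i a]
        exact this.symm
      refine hB.acyclic (d + 2) (by omega) ⟨fun a => x (i + a.1), ?_, ?_⟩
      · intro a b hab
        by_contra hne
        rcases lt_or_gt_of_ne hne with hlt | hlt
        · exact hinj a b hlt (by omega) hab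
        · exact hinj b a hlt (by omega) hab.symm
      · have key : ∀ a b : Fin (d + 2 + 1), b = a + 1 → B (x (i + a.1)) (x (i + b.1)) ≠ 0 := by
          rintro a b rfl
          by_cases ha : a = Fin.last (d + 2)
          · subst ha
            simp only [Fin.last_add_one, Fin.val_zero, add_zero, Fin.val_last]
            have := hx.adj (i + (d + 2)) (by omega)
            rwa [← h]
          · rw [Fin.val_add_one_of_lt (lt_of_le_of_ne (Fin.le_last a) ha)]
            have : a.1 < d + 2 := lt_of_le_of_ne (Fin.le_last a) (fun h => ha (Fin.ext h))
            exact hx.adj (i + a) (by omega)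
        intro a b
        have h1 := key a b
        have h2 := key b a
        rw [hB.symm] at h2
        -- The cycle has at least three vertices, so the entries of `tildeA` are at most one and
        -- nonvanishing of `B` suffices.
        have h3 : ¬ (b = a + 1 ∧ a = b + 1) := by
          rintro ⟨h4, h5⟩
          rw [h4, add_assoc a 1 1, left_eq_add] at h5
          have := congrArg Fin.val h5
          rw [Fin.val_add] at this
          simp only [Fin.val_one, Fin.val_zero] at this
          rw [Nat.mod_eq_of_lt (by omega)] at this
          omega
        unfold tildeA
        split_ifs with h4 h5 h5
        · exact absurd ⟨h4, h5⟩ h3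
        · exact Nat.one_le_iff_ne_zero.2 (h1 h4)
        · exact Nat.one_le_iff_ne_zero.2 (h2 h5)
        · exact Nat.zero_le _

theorem IsNonbacktracking.inj (hB : IsForest B) {x : ℕ → X} {k : ℕ}
    (hx : IsNonbacktracking B x k) {i j : ℕ} (hi : i ≤ k) (hj : j ≤ k) (h : x i = x j) :
    i = j := by
  by_contra hne
  rcases lt_or_gt_of_ne hne with hlt | hlt
  · obtain ⟨d, rfl⟩ := Nat.exists_eq_add_of_lt hlt
    exact hx.ne_of_lt hB d i hj h.symm
  · obtain ⟨d, rfl⟩ := Nat.exists_eq_add_of_lt hlt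
    exact hx.ne_of_lt hB d j hi h

/-- Walk `x` backwards to the common origin, then along `y`; `h1` prevents a turn back at the
junction. -/
theorem IsNonbacktracking.concat (hB : IsForest B) {x y : ℕ → X} {k l : ℕ}
    (hx : IsNonbacktracking B x k) (hy : IsNonbacktracking B y l) (h0 : x 0 = y 0)
    (h1 : x 1 ≠ y 1) :
    IsNonbacktracking B (fun m => if m ≤ k then x (k - m) else y (m - k)) (k + l) := by
  have hz : ∀ m, k ≤ m → (if m ≤ k then x (k - m) else y (m - k)) = y (m - k) := by
    intro m hm
    split_ifs with h
    · obtain rfl := le_antisymm h hm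
      simpa using h0
    · rfl
  constructor
  · intro i hi
    by_cases hik : i < k
    · rw [if_pos hik.le, if_pos (by omega), hB.adj_comm]
      have := hx.adj (k - (i + 1)) (by omega)
      rwa [show k - (i + 1) + 1 = k - i by omega] at this
    · rw [hz i (by omega), hz (i + 1) (by omega), Nat.sub_add_comm (by omega)]
      exact hy.adj _ (by omega)
  · intro i hi
    by_cases hik : i + 2 ≤ k
    · rw [if_pos hik, if_pos (show i ≤ k by omega)]
      have := hx.ne (k - (i + 2)) (by omega)
      rw [show k - (i + 2) + 2 = k - i by omega] at this
      exact this.symm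
    by_cases hik' : k ≤ i
    · rw [hz i hik', hz (i + 2) (by omega), Nat.sub_add_comm hik']
      exact hy.ne _ (by omega)
    · rw [if_neg hik, if_pos (show i ≤ k by omega), show k - i = 1 by omega, show i + 2 - k = 1 by omega]
      exact h1.symm

theorem IsNonbacktracking.inj_concat (hB : IsForest B) {x y : ℕ → X} {k l : ℕ}
    (hx : IsNonbacktracking B x k) (hy : IsNonbacktracking B y l) (h0 : x 0 = y 0)
    (h1 : x 1 ≠ y 1) {i j : ℕ} (hi : i ≤ k) (hj : j ≤ l) (h : x i = y j) : i = 0 ∧ j = 0 := by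
  rcases Nat.eq_zero_or_pos j with rfl | hj0
  · rw [← h0] at h
    exact ⟨hx.inj hB hi (Nat.zero_le _) h, rfl⟩
  have := (hx.concat hB hy h0 h1).inj hB (i := k - i) (j := k + j) (by omega) (by omega) (by
    rw [if_pos (by omega), if_neg (by omega), show k - (k - i) = i by omega,
      show k + j - k = j by omega]
    exact h)
  omega

theorem IsNonbacktracking.snoc {x : ℕ → X} {k : ℕ} (hx : IsNonbacktracking B x k) {y : X}
    (hy : B (x k) y ≠ 0) (hne : ∀ i, i + 1 = k → y ≠ x i) :
    IsNonbacktracking B (Function.update x (k + 1) y) (k + 1) := by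
  have h : ∀ i ≤ k, Function.update x (k + 1) y i = x i := fun i hi =>
    Function.update_of_ne (by omega) _ _
  constructor
  · intro i hi
    rw [h i (by omega)]
    rcases eq_or_ne i k with rfl | hik
    · simpa using hy
    · rw [h (i + 1) (by omega)]
      exact hx.adj i (by omega)
  · intro i hi
    rw [h i (by omega)]
    rcases eq_or_ne (i + 1) k with rfl | hik
    · simpa using hne i rfl
    · rw [h (i + 2) (by omega)]
      exact hx.ne i (by omega)

theorem isNonbacktracking_single {c b : X} (h : B c b ≠ 0) :
    IsNonbacktracking B (fun i => if i = 0 then c else b) 1 := by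
  constructor
  · intro i hi
    obtain rfl : i = 0 := by omega
    simpa using h
  · intro i hi
    omega

/-- A nonbacktracking walk whose inner vertices, except possibly its origin, have no
neighbours outside of it. -/
structure IsArm (B : FinQuiver X) (x : ℕ → X) (k : ℕ) : Prop extends IsNonbacktracking B x k where
  pos : 0 < k
  inner : ∀ i, i + 1 < k → ∀ y, B (x (i + 1)) y ≠ 0 → y = x i ∨ y = x (i + 2)

/-- The arm ends with a vertex of degree one. -/
def EndsAtLeaf (B : FinQuiver X) (x : ℕ → X) (k : ℕ) : Prop :=
  ∀ y, B (x k) y ≠ 0 → y = x (k - 1)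

/-- The arm ends with a vertex of degree at least three. -/
def EndsAtBranch (B : FinQuiver X) (x : ℕ → X) (k : ℕ) : Prop :=
  ∃ y z, y ≠ z ∧ y ≠ x (k - 1) ∧ z ≠ x (k - 1) ∧ B (x k) y ≠ 0 ∧ B (x k) z ≠ 0

theorem exists_arm [Finite X] (hB : IsForest B) {c b : X} (hcb : B c b ≠ 0) :
    ∃ x k, IsArm B x k ∧ x 0 = c ∧ x 1 = b ∧ (EndsAtLeaf B x k ∨ EndsAtBranch B x k) := by
  by_contra! hno
  have main : ∀ k, ∃ x, IsArm B x (k + 1) ∧ x 0 = c ∧ x 1 = b := by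
    intro k
    induction k with
    | zero =>
      exact ⟨_, ⟨isNonbacktracking_single hcb, one_pos, by omega⟩, rfl, rfl⟩
    | succ k ih =>
      obtain ⟨x, hx, h0, h1⟩ := ih
      obtain ⟨hl, hb⟩ := hno x (k + 1) hx h0 h1
      simp only [EndsAtLeaf, not_forall, Nat.add_sub_cancel] at hl
      obtain ⟨y, hy, hyk⟩ := hl
      have hu : ∀ i ≤ k + 1, Function.update x (k + 1 + 1) y i = x i := fun i hi =>
        Function.update_of_ne (by omega) _ _
      refine ⟨Function.update x (k + 1 + 1) y,
        ⟨hx.snoc hy fun i hi => by obtain rfl : i = k := by omega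
                                   exact hyk, by omega, ?_⟩, ?_, ?_⟩
      · intro i hi z hz
        rw [hu (i + 1) (by omega)] at hz
        rw [hu i (by omega)]
        rcases eq_or_ne i k with rfl | hik
        · simp only [Function.update_self]
          by_contra! h
          exact hb ⟨y, z, h.2.symm, hyk, h.1, hy, hz⟩
        · rw [hu (i + 2) (by omega)]
          exact hx.inner i (by omega) z hz
      · rw [hu 0 (by omega), h0]
      · rw [hu 1 (by omega), h1]
  -- An arm this long has more distinct vertices than `X`.
  obtain ⟨x, hx, -⟩ := main (Nat.card X)
  have hinj : Function.Injective fun i : Fin (Nat.card X + 1) => x i := by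
    intro i j hij
    exact Fin.ext (hx.inj hB (by omega) (by omega) hij)
  have := Nat.card_le_card_of_injective _ hinj
  simp at this

theorem IsForest.sum_eq [Fintype X] (hB : IsForest B) {u : X → ℝ} (hu : IsHarmonic B u)
    {c : X} {s : Finset X} (hs : ∀ y, y ∈ s ↔ B c y ≠ 0) : 2 * u c = ∑ y ∈ s, u y := by
  classical
  have h : s = univ.filter fun y => B c y ≠ 0 := by ext; simp [hs]
  rw [← hu.2 c, h, Finset.sum_filter]
  refine Finset.sum_congr rfl fun y _ => ?_
  split_ifs with hy
  · rw [hB.eq_one hy]; simp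
  · rw [not_not.1 hy]; simp

/-- Counted from the leaf, `u` runs through `1, 2, 3, …` times its value there, so it is `k` such
units at `x 1` and `k + 1` at `x 0`. -/
theorem IsArm.value [Fintype X] (hB : IsForest B) {u : X → ℝ} (hu : IsHarmonic B u)
    {x : ℕ → X} {k : ℕ} (hx : IsArm B x k) (hl : EndsAtLeaf B x k) :
    ((k : ℝ) + 1) * u (x 1) = k * u (x 0) := by
  classical
  have main : ∀ j, j + 1 ≤ k → u (x (k - j)) = (j + 1) * u (x k) ∧
      u (x (k - (j + 1))) = (j + 2) * u (x k) := by
    intro j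
    induction j with
    | zero =>
      intro hk
      refine ⟨by simp, ?_⟩
      have hadj := hx.adj (k - 1) (by omega)
      rw [hB.adj_comm, show k - 1 + 1 = k by omega] at hadj
      have := hB.sum_eq hu (c := x k) (s := {x (k - 1)}) (fun y => by
        rw [mem_singleton]
        exact ⟨fun h => h ▸ hadj, hl y⟩)
      rw [sum_singleton] at this
      simp [this]
    | succ j ih =>
      intro hk
      obtain ⟨h1, h2⟩ := ih (by omega)
      have hinner := hx.inner (k - (j + 2)) (by omega)
      have hadj := hx.adj (k - (j + 2)) (by omega)
      have hadj' := hx.adj (k - (j + 2) + 1) (by omega)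
      have hne := hx.ne (k - (j + 2)) (by omega)
      rw [hB.adj_comm] at hadj
      have := hB.sum_eq hu (c := x (k - (j + 2) + 1))
        (s := {x (k - (j + 2)), x (k - (j + 2) + 2)}) (fun y => by
        rw [mem_insert, mem_singleton]
        exact ⟨by rintro (rfl | rfl) <;> assumption, hinner y⟩)
      rw [sum_pair hne.symm, show k - (j + 2) + 1 = k - (j + 1) by omega,
        show k - (j + 2) + 2 = k - j by omega, h1, h2] at this
      refine ⟨by rw [h2]; push_cast; ring, ?_⟩
      rw [show j + 1 + 1 = j + 2 by rfl]
      push_cast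
      linarith
  obtain ⟨h1, h2⟩ := main (k - 1) (by have := hx.pos; omega)
  have hk := hx.pos
  rw [show k - 1 + 1 = k by omega, Nat.sub_self] at h2
  rw [show k - (k - 1) = 1 by omega] at h1
  have : ((k - 1 : ℕ) : ℝ) = k - 1 := by push_cast [hk]; rfl
  rw [h1, h2, this]
  ring

end Sequences

/-! ### Finding an extended ADE component -/

section Classification

/-- Every vertex of `H` is joined to a root by a walk of decreasing height. -/
def IsRooted {W : Type*} (H : FinQuiver W) : Prop :=
  ∃ (r : W) (g : W → ℕ), ∀ a, a = r ∨ ∃ b, g b < g a ∧ H a b ≠ 0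

theorem isRooted_of_forall_lt {n : ℕ} {H : FinQuiver (Fin (n + 1))}
    (h : ∀ a, a ≠ 0 → ∃ b < a, H a b ≠ 0) : IsRooted H := by
  refine ⟨0, fun a => a.1, fun a => or_iff_not_imp_left.2 fun ha => ?_⟩
  obtain ⟨b, hb, hab⟩ := h a ha
  exact ⟨b, hb, hab⟩

theorem tildeA_isRooted (n : ℕ) : IsRooted (tildeA n) := by
  refine isRooted_of_forall_lt fun a ha => ⟨a - 1, ?_, ?_⟩
  · rcases n with _ | n
    · exact absurd (Fin.fin_one_eq_zero a) ha
    · exact Fin.sub_one_lt_iff.2 (Fin.pos_iff_ne_zero.2 ha)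
  · simp [tildeA]

theorem tildeD_isRooted (k : ℕ) : IsRooted (tildeD (k + 4)) := by
  -- The root is the centre `2`; its leaves `0` and `1` are raised above it.
  refine ⟨⟨2, by omega⟩, fun a => if a.1 ≤ 1 then 3 else a.1, fun a => ?_⟩
  have ha := a.2
  simp only [Fin.ext_iff, tildeD, graphOfRel]
  by_cases h2 : a.1 = 2
  · exact Or.inl h2
  right
  by_cases h1 : a.1 ≤ 1
  · refine ⟨⟨2, by omega⟩, by simp [h1], ?_⟩
    rw [if_pos (by dsimp only; omega)]
    exact one_ne_zero
  by_cases h3 : a.1 = k + 4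
  · refine ⟨⟨k + 2, by omega⟩, by dsimp only; split_ifs <;> omega, ?_⟩
    rw [if_pos (by dsimp only; omega)]
    exact one_ne_zero
  · refine ⟨⟨a.1 - 1, by omega⟩, by dsimp only; split_ifs <;> omega, ?_⟩
    rw [if_pos (by dsimp only; omega)]
    exact one_ne_zero

variable {X : Type*} {B : FinQuiver X}

/-- Some component of `B` is a connected graph of extended ADE type. -/
def HasTildeADEChart (B : FinQuiver X) : Prop :=
  ∃ (m : ℕ) (H : FinQuiver (Fin m)) (f : Fin m → X),
    H.IsTildeADE ∧ H.IsGraph ∧ IsRooted H ∧ IsChart H B f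

theorem FinQuiver.Iso.refl {W : Type*} (H : FinQuiver W) : H.Iso H :=
  ⟨Equiv.refl W, fun _ _ => rfl⟩

theorem hasTildeADEChart_of_embeds_tildeA [Fintype X] {u : X → ℝ} (hu : IsHarmonic B u) {n : ℕ}
    (hn : 1 ≤ n) (h : Embeds (tildeA n) B) : HasTildeADEChart B := by
  obtain ⟨f, hf, hle⟩ := h
  exact ⟨_, tildeA n, f, Or.inl ⟨n, hn, .refl _⟩, tildeA_isGraph n, tildeA_isRooted n,
    isChart_of_isNullVector hu (tildeA_isGraph n) (tildeA_isNullVector n) hf hle⟩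

theorem IsForest.graphOfRel_le (hB : IsForest B) {n : ℕ} {r : ℕ → ℕ → Prop} [DecidableRel r]
    {F : ℕ → X} (h : ∀ i ≤ n, ∀ j ≤ n, r i j → B (F i) (F j) ≠ 0) (a b : Fin (n + 1)) :
    graphOfRel n r a b ≤ B (F a) (F b) := by
  unfold graphOfRel
  split_ifs with hr
  · rw [Nat.one_le_iff_ne_zero]
    rcases hr with hr | hr
    · exact h a (by omega) b (by omega) hr
    · exact hB.adj_comm.2 (h b (by omega) a (by omega) hr)
  · exact Nat.zero_le _

theorem hasTildeADEChart_of_two_forks [Fintype X] {u : X → ℝ} (hu : IsHarmonic B u)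
    (hB : IsForest B) {x : ℕ → X} {k : ℕ} (hx : IsNonbacktracking B x k) {y₁ y₂ z₁ z₂ : X}
    (hy₁ : B (x 0) y₁ ≠ 0) (hy₂ : B (x 0) y₂ ≠ 0) (hz₁ : B (x k) z₁ ≠ 0) (hz₂ : B (x k) z₂ ≠ 0)
    (hy : y₁ ≠ y₂) (hz : z₁ ≠ z₂) (h₁₁ : y₁ ≠ z₁) (h₁₂ : y₁ ≠ z₂) (h₂₁ : y₂ ≠ z₁)
    (h₂₂ : y₂ ≠ z₂) (hxy₁ : ∀ i ≤ k, x i ≠ y₁) (hxy₂ : ∀ i ≤ k, x i ≠ y₂)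
    (hxz₁ : ∀ i ≤ k, x i ≠ z₁) (hxz₂ : ∀ i ≤ k, x i ≠ z₂) : HasTildeADEChart B := by
  -- Labelling of `tildeD (k + 4)`: the walk `x` occupies the places `2, …, k + 2`.
  let F : ℕ → X := fun a => if a = 0 then y₁ else if a = 1 then y₂ else
    if a ≤ k + 2 then x (a - 2) else if a = k + 3 then z₁ else z₂
  have F0 : F 0 = y₁ := rfl
  have F1 : F 1 = y₂ := rfl
  have F2 : ∀ i ≤ k, F (i + 2) = x i := fun i hi => by simp [F, hi]
  have F3 : F (k + 3) = z₁ := by simp [F]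
  have F4 : F (k + 4) = z₂ := by simp [F]
  have hcases : ∀ a ≤ k + 4, a = 0 ∨ a = 1 ∨ (∃ i ≤ k, a = i + 2) ∨ a = k + 3 ∨ a = k + 4 := by
    intro a ha
    by_cases h : 2 ≤ a ∧ a ≤ k + 2
    · exact Or.inr (Or.inr (Or.inl ⟨a - 2, by omega, by omega⟩))
    · omega
  have hinj : ∀ a ≤ k + 4, ∀ b ≤ k + 4, a < b → F a ≠ F b := by
    intro a ha b hb hab
    rcases hcases a ha with rfl | rfl | ⟨i, hi, rfl⟩ | rfl | rfl <;>
    rcases hcases b hb with rfl | rfl | ⟨j, hj, rfl⟩ | rfl | rfl <;>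
    first
    | omega
    | exact hy
    | (rw [F2 j hj]; exact (hxy₁ _ hj).symm)
    | (rw [F2 j hj]; exact (hxy₂ _ hj).symm)
    | (rw [F3]; first | exact h₁₁ | exact h₂₁)
    | (rw [F4]; first | exact h₁₂ | exact h₂₂)
    | (rw [F2 i hi, F3]; exact hxz₁ _ hi)
    | (rw [F2 i hi, F4]; exact hxz₂ _ hi)
    | (rw [F2 i hi, F2 j hj]; exact fun h => absurd (hx.inj hB hi hj h) (by omega))
    | (rw [F3, F4]; exact hz)
  refine ⟨_, tildeD (k + 4), fun a => F a, Or.inr (Or.inl ⟨k + 4, by omega, .refl _⟩),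
    graphOfRel_isGraph _ _, tildeD_isRooted k,
    isChart_of_isNullVector hu (graphOfRel_isGraph _ _) (tildeD_isNullVector k) ?_ ?_⟩
  · intro a b hab
    by_contra hne
    rcases lt_or_gt_of_ne hne with hlt | hlt
    · exact hinj a (by omega) b (by omega) hlt hab
    · exact hinj b (by omega) a (by omega) hlt hab.symm
  · refine hB.graphOfRel_le ?_
    rintro i hi' j hj (⟨rfl, rfl⟩ | ⟨h1, rfl, h3⟩ | ⟨h1, rfl⟩)
    · rw [F0, F2 0 (Nat.zero_le _), hB.adj_comm]
      exact hy₁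
    · rcases hcases i hi' with rfl | rfl | ⟨i, hi, rfl⟩ | rfl | rfl
      · omega
      · rw [F1, F2 0 (Nat.zero_le _), hB.adj_comm]
        exact hy₂
      · rcases eq_or_ne i k with rfl | hik
        · rw [F2 i le_rfl, F3]
          exact hz₁
        · rw [F2 i hi, show i + 2 + 1 = i + 1 + 2 by rfl, F2 (i + 1) (by omega)]
          exact hx.adj i (by omega)
      · omega
      · omega
    · obtain rfl : i = k + 2 := by omega
      rw [F2 k le_rfl, F4]
      exact hz₂

theorem hasTildeADEChart_of_endsAtBranch [Fintype X] {u : X → ℝ} (hu : IsHarmonic B u)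
    (hB : IsForest B) {x : ℕ → X} {k : ℕ} (hx : IsArm B x k) (hb : EndsAtBranch B x k)
    {y₁ y₂ : X} (hy₁ : B (x 0) y₁ ≠ 0) (hy₂ : B (x 0) y₂ ≠ 0) (hy : y₁ ≠ y₂) (h₁ : x 1 ≠ y₁)
    (h₂ : x 1 ≠ y₂) : HasTildeADEChart B := by
  obtain ⟨z₁, z₂, hz, hk₁, hk₂, hz₁, hz₂⟩ := hb
  have hk := hx.pos
  have key : ∀ z, z ≠ x (k - 1) → B (x k) z ≠ 0 → (∀ i ≤ k, x i ≠ z) ∧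
      ∀ y, B (x 0) y ≠ 0 → x 1 ≠ y → y ≠ z ∧ ∀ i ≤ k, x i ≠ y := by
    intro z hzk hz
    -- All required distinctness comes from injectivity of the arm prolonged by `z` and joined at
    -- its origin to the edge towards `y`.
    have hs := hx.toIsNonbacktracking.snoc hz fun i hi => by
      obtain rfl : i = k - 1 := by omega
      exact hzk
    have he : ∀ i ≤ k, Function.update x (k + 1) z i = x i := fun i hi =>
      Function.update_of_ne (by omega) _ _
    have he' : Function.update x (k + 1) z (k + 1) = z := Function.update_self _ _ _
    refine ⟨fun i hi h => ?_, fun y hy hne => ?_⟩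
    · have := hs.inj hB (i := i) (j := k + 1) (by omega) le_rfl (by rw [he i hi, he', h])
      omega
    · have hcon := fun i (hi : i ≤ k + 1) h => hs.inj_concat hB (isNonbacktracking_single hy)
        (he 0 (by omega)) (by rw [he 1 hk]; exact hne) (i := i) (j := 1) hi le_rfl h
      refine ⟨fun h => ?_, fun i hi h => ?_⟩
      · have := hcon (k + 1) le_rfl (by rw [he', ← h]; rfl)
        omega
      · have := hcon i (by omega) (by rw [he i hi, h]; rfl)
        omega
  obtain ⟨a₁, c₁⟩ := key z₁ hk₁ hz₁
  obtain ⟨a₂, c₂⟩ := key z₂ hk₂ hz₂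
  exact hasTildeADEChart_of_two_forks hu hB hx.toIsNonbacktracking hy₁ hy₂ hz₁ hz₂ hy hz
    (c₁ y₁ hy₁ h₁).1 (c₂ y₁ hy₁ h₁).1 (c₁ y₂ hy₂ h₂).1 (c₂ y₂ hy₂ h₂).1
    (c₁ y₁ hy₁ h₁).2 (c₁ y₂ hy₂ h₂).2 a₁ a₂

theorem hasTildeADEChart_of_four_neighbours [Fintype X] {u : X → ℝ} (hu : IsHarmonic B u)
    (hB : IsForest B) {c : X} {b : Fin 3 → X} (hb : Function.Injective b)
    (hcb : ∀ s, B c (b s) ≠ 0) {y : X} (hy : B c y ≠ 0) (hyb : ∀ s, y ≠ b s) :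
    HasTildeADEChart B := by
  have hx : IsNonbacktracking B (fun _ => c) 0 := ⟨by omega, by omega⟩
  have hne : ∀ s t, s ≠ t → b s ≠ b t := fun s t h => hb.ne h
  exact hasTildeADEChart_of_two_forks hu hB hx hy (hcb 0) (hcb 1) (hcb 2) (hyb 0)
    (hne _ _ (by decide)) (hyb 1) (hyb 2) (hne _ _ (by decide)) (hne _ _ (by decide))
    (fun _ _ => hB.ne hy) (fun _ _ => hB.ne (hcb 0)) (fun _ _ => hB.ne (hcb 1))
    (fun _ _ => hB.ne (hcb 2))

/-- Polar coordinates: vertex `a` of `H` goes to position `p a` on arm `s a`. Position `0` is the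
centre on every arm, which explains the disjunctions `p a = 0 ∨ s a = s b`. -/
theorem isChart_of_star [Fintype X] {u : X → ℝ} (hu : IsHarmonic B u) (hB : IsForest B)
    {c : X} {g : Fin 3 → ℕ → X} {l : Fin 3 → ℕ} (hg : ∀ s, IsNonbacktracking B (g s) (l s))
    (h0 : ∀ s, g s 0 = c) (h1 : Function.Injective fun s => g s 1)
    {m : ℕ} {H : FinQuiver (Fin m)} {δ : Fin m → ℕ} (hH : H.IsGraph) (hδ : IsNullVector H δ)
    (s : Fin m → Fin 3) (p : Fin m → ℕ) (hp : ∀ a, p a ≤ l (s a))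
    (hsp : ∀ a b, p a = p b → (p a = 0 ∨ s a = s b) → a = b)
    (hHsp : ∀ a b, H a b = 0 ∨ H a b = 1 ∧
      (p b = p a + 1 ∧ (p a = 0 ∨ s a = s b) ∨ p a = p b + 1 ∧ (p b = 0 ∨ s a = s b))) :
    IsChart H B fun a => g (s a) (p a) := by
  refine isChart_of_isNullVector hu hH hδ ?_ ?_
  · intro a b hab
    rcases eq_or_ne (s a) (s b) with hs | hs
    · dsimp only at hab
      rw [hs] at hab
      exact hsp a b ((hg (s b)).inj hB (hs ▸ hp a) (hp b) hab) (Or.inr hs)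
    · obtain ⟨ha, hb⟩ := (hg (s a)).inj_concat hB (hg (s b)) ((h0 _).trans (h0 _).symm)
        (h1.ne hs) (hp a) (hp b) hab
      exact hsp a b (ha.trans hb.symm) (Or.inl ha)
  · have key : ∀ a b, p b = p a + 1 ∧ (p a = 0 ∨ s a = s b) →
        B (g (s a) (p a)) (g (s b) (p b)) ≠ 0 := by
      rintro a b ⟨hab, h⟩
      have : g (s a) (p a) = g (s b) (p a) := by
        rcases h with h | h
        · rw [h, h0, h0]
        · rw [h]
      rw [this, hab]
      exact (hg (s b)).adj _ (by have := hp b; omega)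
    intro a b
    rcases hHsp a b with h | ⟨h, h' | ⟨h', h''⟩⟩
    · rw [h]
      exact Nat.zero_le _
    · rw [h]
      exact Nat.one_le_iff_ne_zero.2 (key a b h')
    · rw [h]
      exact Nat.one_le_iff_ne_zero.2 (hB.adj_comm.1 (key b a ⟨h', h''.imp_right Eq.symm⟩))

/-- This is `1/(p+1) + 1/(q+1) + 1/(r+1) = 1` with denominators cleared. If `p ≥ 3`, the left side
is at most `3/4`. -/
theorem eq_of_unit_fractions {p q r : ℕ} (hp : 0 < p) (hpq : p ≤ q) (hqr : q ≤ r)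
    (h : (q + 1) * (r + 1) + (p + 1) * (r + 1) + (p + 1) * (q + 1)
      = (p + 1) * (q + 1) * (r + 1)) :
    p = 1 ∧ q = 2 ∧ r = 5 ∨ p = 1 ∧ q = 3 ∧ r = 3 ∨ p = 2 ∧ q = 2 ∧ r = 2 := by
  have hp2 : p ≤ 2 := by
    by_contra! hp2
    have h1 : (p + 1) * (r + 1) ≤ (q + 1) * (r + 1) := by gcongr
    have h2 : (p + 1) * (q + 1) ≤ (r + 1) * (q + 1) := by gcongr; omega
    have h3 : 4 * ((q + 1) * (r + 1)) ≤ (p + 1) * ((q + 1) * (r + 1)) := by gcongr; omega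
    nlinarith
  interval_cases p
  · have hq : q ≤ 3 := by
      by_contra! hq
      nlinarith
    interval_cases q <;> omega
  · have hq : q ≤ 2 := by
      by_contra! hq
      nlinarith
    interval_cases q
    omega

theorem hasTildeADEChart_of_star [Fintype X] {u : X → ℝ} (hu : IsHarmonic B u) (hB : IsForest B)
    {c : X} {g : Fin 3 → ℕ → X} {l : Fin 3 → ℕ} (hg : ∀ s, IsArm B (g s) (l s))
    (hl : ∀ s, EndsAtLeaf B (g s) (l s)) (h0 : ∀ s, g s 0 = c)
    (h1 : Function.Injective fun s => g s 1) (hmono : Monotone l)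
    (hsum : 2 * u c = ∑ s, u (g s 1)) : HasTildeADEChart B := by
  have hg' := fun s => (hg s).toIsNonbacktracking
  have hval : ∀ s, u (g s 1) = (l s : ℝ) / (l s + 1) * u c := by
    intro s
    have := (hg s).value hB hu (hl s)
    rw [h0] at this
    field_simp
    linarith
  -- Dividing the harmonic relation at `c` by `u c` gives `∑ l/(l+1) = 2`, that is, `∑ 1/(l+1) = 1`.
  have hlen := eq_of_unit_fractions (p := l 0) (q := l 1) (r := l 2) (hg 0).pos
    (hmono (by decide)) (hmono (by decide)) (by
      have hc := (hu.1 c).ne'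
      simp only [hval, ← Finset.sum_mul] at hsum
      have := mul_right_cancel₀ hc hsum
      rw [Fin.sum_univ_three] at this
      field_simp at this
      rw [← Nat.cast_inj (R := ℝ)]
      push_cast
      linarith)
  have hle : ∀ {m : ℕ} {s : Fin m → Fin 3} {p : Fin m → ℕ} {l' : Fin 3 → ℕ},
      l = l' → (∀ a, p a ≤ l' (s a)) → ∀ a, p a ≤ l (s a) := by
    rintro m s p l' rfl h
    exact h
  rcases hlen with ⟨hp, hq, hr⟩ | ⟨hp, hq, hr⟩ | ⟨hp, hq, hr⟩
  · have hl' : l = ![1, 2, 5] := by funext s; fin_cases s <;> simp [hp, hq, hr]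
    exact ⟨_, tildeE8, _, by simp [FinQuiver.IsTildeADE, FinQuiver.Iso.refl],
      graphOfRel_isGraph _ _,
      isRooted_of_forall_lt (by simp only [tildeE8, graphOfRel]; decide),
      isChart_of_star hu hB hg' h0 h1 (graphOfRel_isGraph _ _) tildeE8_isNullVector
        ![1, 1, 1, 2, 2, 2, 2, 2, 0] ![2, 1, 0, 1, 2, 3, 4, 5, 1] (hle hl' (by decide))
        (by decide) (by simp only [graphOfRel]; decide)⟩
  · have hl' : l = ![1, 3, 3] := by funext s; fin_cases s <;> simp [hp, hq, hr]
    exact ⟨_, tildeE7, _, by simp [FinQuiver.IsTildeADE, FinQuiver.Iso.refl],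
      graphOfRel_isGraph _ _,
      isRooted_of_forall_lt (by simp only [tildeE7, graphOfRel]; decide),
      isChart_of_star hu hB hg' h0 h1 (graphOfRel_isGraph _ _) tildeE7_isNullVector
        ![1, 1, 1, 1, 2, 2, 2, 0] ![3, 2, 1, 0, 1, 2, 3, 1] (hle hl' (by decide))
        (by decide) (by simp only [graphOfRel]; decide)⟩
  · have hl' : l = ![2, 2, 2] := by funext s; fin_cases s <;> simp [hp, hq, hr]
    exact ⟨_, tildeE6, _, by simp [FinQuiver.IsTildeADE, FinQuiver.Iso.refl],
      graphOfRel_isGraph _ _,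
      isRooted_of_forall_lt (by simp only [tildeE6, graphOfRel]; decide),
      isChart_of_star hu hB hg' h0 h1 (graphOfRel_isGraph _ _) tildeE6_isNullVector
        ![0, 0, 0, 1, 1, 2, 2] ![2, 1, 0, 1, 2, 1, 2] (hle hl' (by decide))
        (by decide) (by simp only [graphOfRel]; decide)⟩

/-- Without branch vertices every arm ends at a leaf, so `u` strictly decreases along every edge, in
both directions at once. -/
theorem exists_three_neighbours [Fintype X] [Nonempty X] {u : X → ℝ} (hu : IsHarmonic B u)
    (hB : IsForest B) :
    ∃ (c : X) (b : Fin 3 → X), Function.Injective b ∧ ∀ s, B c (b s) ≠ 0 := by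
  classical
  have mk : ∀ c b₀ b₁ b₂, b₀ ≠ b₁ → b₀ ≠ b₂ → b₁ ≠ b₂ → B c b₀ ≠ 0 → B c b₁ ≠ 0 →
      B c b₂ ≠ 0 → ∃ (c : X) (b : Fin 3 → X), Function.Injective b ∧ ∀ s, B c (b s) ≠ 0 := by
    intro c b₀ b₁ b₂ h01 h02 h12 h0 h1 h2
    refine ⟨c, ![b₀, b₁, b₂], ?_, ?_⟩
    · intro s t
      fin_cases s <;> fin_cases t <;> simp [h01, h02, h12, h01.symm, h02.symm, h12.symm]
    · intro s
      fin_cases s <;> assumption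
  by_contra hno
  have hlt : ∀ c b, B c b ≠ 0 → u b < u c := by
    intro c b hcb
    obtain ⟨x, k, hx, rfl, rfl, hl | hb⟩ := exists_arm hB hcb
    · have := hx.value hB hu hl
      have h0 := hu.1 (x 0)
      have hk : (0 : ℝ) ≤ k := Nat.cast_nonneg k
      by_contra! h
      nlinarith
    · obtain ⟨y, z, hyz, hy, hz, hky, hkz⟩ := hb
      have hpos := hx.pos
      have := hx.adj (k - 1) (by omega)
      rw [hB.adj_comm, show k - 1 + 1 = k by omega] at this
      exact absurd (mk (x k) _ y z hy.symm hz.symm hyz this hky hkz) hno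
  obtain ⟨c⟩ := ‹Nonempty X›
  have hc : ∃ b, B c b ≠ 0 := by
    by_contra! h
    have h1 := hu.2 c
    have h2 := hu.1 c
    simp [h] at h1
    exact h2.ne' h1
  obtain ⟨b, hb⟩ := hc
  exact (hlt c b hb).not_gt (hlt b c (hB.adj_comm.1 hb))

theorem hasTildeADEChart [Fintype X] [Nonempty X] {u : X → ℝ} (hu : IsHarmonic B u)
    (hsymm : ∀ i j, B i j = B j i) (hloop : ∀ i, B i i = 0) : HasTildeADEChart B := by
  classical
  by_cases hA : ∃ n, 1 ≤ n ∧ Embeds (tildeA n) B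
  · obtain ⟨n, hn, h⟩ := hA
    exact hasTildeADEChart_of_embeds_tildeA hu hn h
  have hB : IsForest B := ⟨hsymm, hloop, fun n hn h => hA ⟨n, hn, h⟩⟩
  obtain ⟨c, b, hb, hcb⟩ := exists_three_neighbours hu hB
  by_cases hfour : ∃ y, B c y ≠ 0 ∧ ∀ s, y ≠ b s
  · obtain ⟨y, hy, hyb⟩ := hfour
    exact hasTildeADEChart_of_four_neighbours hu hB hb hcb hy hyb
  push Not at hfour
  choose g l hg h0 h1 hend using fun s => exists_arm hB (hcb s)
  by_cases hbranch : ∃ s, EndsAtBranch B (g s) (l s)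
  · obtain ⟨s, hs⟩ := hbranch
    -- Modulo three, `s + 1` and `s + 2` are the other two arms, which supply the fork at `c`.
    obtain ⟨hs1, hs2, hs3⟩ : s ≠ s + 1 ∧ s ≠ s + 2 ∧ s + 1 ≠ s + 2 := by
      clear hs
      revert s
      decide
    refine hasTildeADEChart_of_endsAtBranch hu hB (hg s) hs (y₁ := b (s + 1)) (y₂ := b (s + 2))
      ?_ ?_ (hb.ne hs3) ?_ ?_
    · rw [h0]; exact hcb _
    · rw [h0]; exact hcb _
    · rw [h1]; exact hb.ne hs1
    · rw [h1]; exact hb.ne hs2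
  have hl : ∀ s, EndsAtLeaf B (g s) (l s) := fun s =>
    (hend s).resolve_right fun h => hbranch ⟨s, h⟩
  have hsum : 2 * u c = ∑ s, u (b s) := by
    rw [hB.sum_eq hu (s := univ.image b) (c := c), Finset.sum_image fun _ _ _ _ h => hb h]
    intro y
    simp only [mem_image, mem_univ, true_and]
    exact ⟨by rintro ⟨s, rfl⟩; exact hcb s, fun h => (hfour y h).imp fun _ => Eq.symm⟩
  have hsort := Tuple.monotone_sort l
  refine hasTildeADEChart_of_star hu hB (c := c) (g := g ∘ Tuple.sort l) (l := l ∘ Tuple.sort l)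
    (fun s => hg _) (fun s => hl _) (fun s => h0 _) ?_ hsort ?_
  · simp only [Function.comp, h1]
    exact hb.comp (Tuple.sort l).injective
  · simp only [Function.comp, h1]
    rw [hsum]
    exact (Equiv.sum_comp (Tuple.sort l) fun s => u (b s)).symm

end Classification

end Pretzel

/-! ### Perron vectors of normal quivers -/

namespace Pretzel
open scoped Matrix.Norms.L2Operator

theorem exists_eigenvector_of_specRadius {V : Type*} [Fintype V] [DecidableEq V] [Nonempty V]
    {Q : FinQuiver V} (hρ : Q.specRadius = 2) :
    ∃ (z : ℂ) (v : V → ℂ), ‖z‖ = 2 ∧ v ≠ 0 ∧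
      Matrix.mulVec (Matrix.map Q (fun q : ℕ => (q : ℂ))) v = z • v := by
  obtain ⟨z, hz, hz2⟩ := spectrum.exists_nnnorm_eq_spectralRadius (Matrix.map Q (fun q : ℕ => (q : ℂ)))
  change _ = Q.specRadius at hz2
  rw [hρ] at hz2
  have hz3 : ‖z‖ = 2 := by
    have : ‖z‖₊ = 2 := by exact_mod_cast hz2
    rw [← coe_nnnorm, this]; rfl
  rw [← Matrix.spectrum_toLin', ← Module.End.hasEigenvalue_iff_mem_spectrum] at hz
  obtain ⟨v, hv⟩ := hz.exists_hasEigenvector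
  refine ⟨z, v, hz3, hv.2, ?_⟩
  rw [← Matrix.toLin'_apply]
  exact hv.apply_eq_smul

theorem sum_sq_mulVec_le {V : Type*} [Fintype V] [DecidableEq V] {A : Matrix V V ℂ} {R : V → V → ℝ}
    (hAR : ∀ i j, A i j = R i j) (hA : ‖A‖ ≤ 2) (w : V → ℝ) :
    ∑ i, (∑ j, R i j * w j) ^ 2 ≤ 4 * ∑ i, w i ^ 2 := by
  have h := A.l2_opNorm_mulVec (WithLp.toLp 2 fun i => (w i : ℂ))
  have h2 : A.mulVec (fun i => (w i : ℂ)) = fun i => ((∑ j, R i j * w j : ℝ) : ℂ) := by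
    funext i
    simp [Matrix.mulVec, dotProduct, hAR]
  have h3 := h.trans (mul_le_mul_of_nonneg_right hA (norm_nonneg _))
  have h4 := pow_le_pow_left₀ (norm_nonneg _) h3 2
  rw [mul_pow, EuclideanSpace.norm_sq_eq, EuclideanSpace.norm_sq_eq] at h4
  have h5 : ∀ (g : V → ℂ) (i : V), ((EuclideanSpace.equiv V ℂ).symm g).ofLp i = g i :=
    fun _ _ => rfl
  simp only [h2, h5] at h4
  simp only [Complex.norm_real, Real.norm_eq_abs, sq_abs] at h4
  linarith

/-- The Perron vector of a normal quiver is common to the quiver and its opposite. -/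
theorem exists_common_perron {V : Type*} [Fintype V] [DecidableEq V] [Nonempty V]
    {Q : FinQuiver V} (hQ : Matrix.transpose Q * Q = Q * Matrix.transpose Q)
    (hρ : Q.specRadius = 2) :
    ∃ w : V → ℝ, (∀ i, 0 ≤ w i) ∧ (∃ i, 0 < w i) ∧ (∀ i, ∑ j, (Q i j : ℝ) * w j = 2 * w i) ∧
      ∀ i, ∑ j, (Q j i : ℝ) * w j = 2 * w i := by
  set A : Matrix V V ℂ := Matrix.map Q (fun q : ℕ => (q : ℂ)) with hAdef
  have hA' : A = (Nat.castRingHom ℂ).mapMatrix Q := rfl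
  have hstar : star A = (Nat.castRingHom ℂ).mapMatrix (Matrix.transpose Q) := by
    ext i j
    simp [hA', Matrix.star_apply]
  have hnormal : IsStarNormal A := by
    constructor
    rw [hstar, hA', commute_iff_eq, ← map_mul, ← map_mul, hQ]
  have hnorm : ‖A‖ ≤ 2 := by
    have h := IsStarNormal.spectralRadius_eq_nnnorm A
    change Q.specRadius = _ at h
    rw [hρ] at h
    have : (2 : NNReal) = ‖A‖₊ := by exact_mod_cast h
    rw [← coe_nnnorm, ← this]
    rfl
  have hnorm' : ‖star A‖ ≤ 2 := by rwa [norm_star]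
  obtain ⟨z, v, hz, hv0, hv⟩ := exists_eigenvector_of_specRadius hρ
  -- The triangle inequality gives `2|v| ≤ Q|v|` entrywise; the norm bound then forces equality.
  have hge : ∀ i, 2 * ‖v i‖ ≤ ∑ j, (Q i j : ℝ) * ‖v j‖ := by
    intro i
    have h := congrFun hv i
    simp only [Matrix.mulVec, dotProduct, Matrix.map_apply, Pi.smul_apply, smul_eq_mul] at h
    rw [← hz, ← norm_mul, ← h]
    refine (norm_sum_le _ _).trans (le_of_eq ?_)
    simp
  have hle := sum_sq_mulVec_le (A := A) (R := fun i j => (Q i j : ℝ)) (by simp [hAdef]) hnorm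
    fun i => ‖v i‖
  have hle' := sum_sq_mulVec_le (A := star A) (R := fun i j => (Q j i : ℝ)) (fun i j => by rw [hstar]; simp)
    hnorm' fun i => ‖v i‖
  have heq : ∀ i, ∑ j, (Q i j : ℝ) * ‖v j‖ = 2 * ‖v i‖ := by
    have h1 : ∀ i, 0 ≤ (∑ j, (Q i j : ℝ) * ‖v j‖) ^ 2 - (2 * ‖v i‖) ^ 2 := fun i =>
      sub_nonneg.2 (pow_le_pow_left₀ (by positivity) (hge i) 2)
    have h2 : ∑ i, ((∑ j, (Q i j : ℝ) * ‖v j‖) ^ 2 - (2 * ‖v i‖) ^ 2) = 0 := by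
      refine le_antisymm ?_ (Finset.sum_nonneg fun i _ => h1 i)
      rw [Finset.sum_sub_distrib]
      simp only [mul_pow, ← Finset.mul_sum]
      linarith
    intro i
    have h3 := (Finset.sum_eq_zero_iff_of_nonneg fun i _ => h1 i).1 h2 i (Finset.mem_univ _)
    refine (pow_left_inj₀ (Finset.sum_nonneg fun j _ => by positivity) (by positivity)
      two_ne_zero).1 (sub_eq_zero.1 h3)
  refine ⟨fun i => ‖v i‖, fun i => norm_nonneg _, ?_, heq, ?_⟩
  · obtain ⟨i, hi⟩ := Function.ne_iff.1 hv0
    exact ⟨i, norm_pos_iff.2 hi⟩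
  · have hcross : ∑ i, (∑ j, (Q j i : ℝ) * ‖v j‖) * ‖v i‖ = 2 * ∑ i, ‖v i‖ ^ 2 := by
      simp only [Finset.sum_mul]
      rw [Finset.sum_comm, Finset.mul_sum]
      refine Finset.sum_congr rfl fun j _ => ?_
      calc ∑ i, (Q j i : ℝ) * ‖v j‖ * ‖v i‖ = ‖v j‖ * ∑ i, (Q j i : ℝ) * ‖v i‖ := by
            rw [Finset.mul_sum]
            exact Finset.sum_congr rfl fun i _ => by ring
        _ = 2 * ‖v j‖ ^ 2 := by rw [heq]; ring
    -- With `w = |v|`, expanding `‖Qᵀw - 2w‖²` gives at most `(4 - 8 + 4)‖w‖²`, since `⟨Qᵀw, w⟩ =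
    -- ⟨w, Qw⟩ = 2‖w‖²`.
    have h2 : ∑ i, ((∑ j, (Q j i : ℝ) * ‖v j‖) - 2 * ‖v i‖) ^ 2 = 0 := by
      refine le_antisymm ?_ (Finset.sum_nonneg fun i _ => sq_nonneg _)
      have : ∀ i, ((∑ j, (Q j i : ℝ) * ‖v j‖) - 2 * ‖v i‖) ^ 2 =
          (∑ j, (Q j i : ℝ) * ‖v j‖) ^ 2 - 4 * ((∑ j, (Q j i : ℝ) * ‖v j‖) * ‖v i‖)
            + 4 * ‖v i‖ ^ 2 := fun i => by ring
      simp only [this, Finset.sum_add_distrib, Finset.sum_sub_distrib, ← Finset.mul_sum]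
      rw [hcross]
      linarith
    intro i
    have h3 := (Finset.sum_eq_zero_iff_of_nonneg fun i _ => sq_nonneg _).1 h2 i
      (Finset.mem_univ _)
    exact sub_eq_zero.1 (pow_eq_zero_iff two_ne_zero |>.1 h3)

end Pretzel

namespace Pretzel

/-! ### The bipartite double cover and its swap automorphism -/

section Cover

variable {V : Type*}

/-- The bipartite double cover of a quiver. -/
def FinQuiver.doubleCover (Q : FinQuiver V) : FinQuiver (V ⊕ V) :=
  Matrix.fromBlocks 0 Q Q.op 0

/-- The permutation of `V ⊕ V` which exchanges the two copies, following `σ` one way. -/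
def swapVia (σ : Equiv.Perm V) : Equiv.Perm (V ⊕ V) :=
  (Equiv.sumComm V V).trans (Equiv.sumCongr σ (Equiv.refl V))

variable {Q : FinQuiver V} {σ : Equiv.Perm V}

theorem union_swapVia (hop : Q.op = Q.twist σ) (x y : V ⊕ V) :
    Q.union Q (swapVia σ x) y = Q.doubleCover x y := by
  have h : ∀ i j, Q j i = Q (σ i) j := fun i j => congrFun (congrFun hop i) j
  rcases x with i | i <;> rcases y with j | j <;>
    simp [swapVia, FinQuiver.union, FinQuiver.doubleCover, FinQuiver.op, h i j]

theorem doubleCover_swapVia (hop : Q.op = Q.twist σ) (x y : V ⊕ V) :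
    Q.doubleCover (swapVia σ x) (swapVia σ y) = Q.doubleCover x y := by
  have h : ∀ i j, Q j i = Q (σ i) j := fun i j => congrFun (congrFun hop i) j
  rcases x with i | i <;> rcases y with j | j <;>
    simp [swapVia, FinQuiver.doubleCover, FinQuiver.op, ← h]

theorem doubleCover_symm (Q : FinQuiver V) (x y : V ⊕ V) :
    Q.doubleCover x y = Q.doubleCover y x := by
  rcases x with i | i <;> rcases y with j | j <;> simp [FinQuiver.doubleCover, FinQuiver.op]

theorem doubleCover_self (Q : FinQuiver V) (x : V ⊕ V) : Q.doubleCover x x = 0 := by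
  rcases x with i | i <;> simp [FinQuiver.doubleCover]

/-- Since `Q (σ k) i = Q i k`, reindexing the sum for `QᵀQ` by `σ` turns it into that for `QQᵀ`. -/
theorem transpose_mul_comm [Fintype V] (hop : Q.op = Q.twist σ) :
    Matrix.transpose Q * Q = Q * Matrix.transpose Q := by
  have h : ∀ i j, Q j i = Q (σ i) j := fun i j => congrFun (congrFun hop i) j
  ext i j
  simp only [Matrix.mul_apply, Matrix.transpose_apply]
  rw [← Equiv.sum_comp σ]
  refine Finset.sum_congr rfl fun k _ => ?_
  rw [← h, ← h]

/-- A property of vertices which is invariant along arrows holds everywhere in a connected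
quiver as soon as it holds somewhere. -/
theorem FinQuiver.IsConnected.forall_of_exists (hconn : Q.IsConnected) {p : V → Prop}
    (hp : ∀ i j, Q i j ≠ 0 → (p i ↔ p j)) (hex : ∃ i, p i) (i : V) : p i := by
  obtain ⟨j, hj⟩ := hex
  obtain ⟨w⟩ := hconn.preconnected j i
  induction w with
  | nil => exact hj
  | cons hadj _ ih =>
    refine ih ?_
    rw [SimpleGraph.fromRel_adj] at hadj
    rcases hadj.2 with h | h
    · exact (hp _ _ h).1 hj
    · exact (hp _ _ h).2 hj

theorem isHarmonic_doubleCover [Fintype V] [DecidableEq V] (hconn : Q.IsConnected)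
    (hQ : Matrix.transpose Q * Q = Q * Matrix.transpose Q) (hρ : Q.specRadius = 2) :
    ∃ u, IsHarmonic Q.doubleCover u := by
  have := hconn.nonempty
  obtain ⟨w, hw, hw0, hw1, hw2⟩ := exists_common_perron hQ hρ
  -- Positivity of `w` spreads along arrows, both ways because `w` is an eigenvector of `Q` and of
  -- its transpose.
  have step : ∀ {a : V → ℝ} {i j : V}, (∀ j, 0 ≤ a j) → ∑ j, a j * w j = 2 * w i → a j ≠ 0 →
      0 < w j → 0 < w i := by
    intro a i j ha hsum haj hj
    have h1 : a j * w j ≤ ∑ j, a j * w j :=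
      Finset.single_le_sum (f := fun j => a j * w j) (fun j _ => mul_nonneg (ha j) (hw j))
        (Finset.mem_univ j)
    have h2 : 0 < a j * w j := mul_pos (lt_of_le_of_ne (ha j) haj.symm) hj
    linarith
  have hpos : ∀ i, 0 < w i := hconn.forall_of_exists (fun i j hij =>
    ⟨step (fun _ => Nat.cast_nonneg _) (hw2 j) (Nat.cast_ne_zero.2 hij),
      step (fun _ => Nat.cast_nonneg _) (hw1 i) (Nat.cast_ne_zero.2 hij)⟩) hw0
  refine ⟨Sum.elim w w, fun x => by rcases x with i | i <;> exact hpos i, fun x => ?_⟩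
  rw [Fintype.sum_sum_type]
  rcases x with i | i
  · simpa [FinQuiver.doubleCover] using hw1 i
  · simpa [FinQuiver.doubleCover, FinQuiver.op] using hw2 i

theorem IsChart.comp_aut {X W : Type*} {H : FinQuiver W} {B : FinQuiver X} {f : W → X}
    (hf : IsChart H B f) {τ : Equiv.Perm X} (hτ : B.IsAut τ) : IsChart H B (τ ∘ f) := by
  refine ⟨τ.injective.comp hf.injective, fun a b => (hτ _ _).trans (hf.map_eq a b), ?_⟩
  intro a y hy
  obtain ⟨y, rfl⟩ := τ.surjective y
  obtain ⟨b, rfl⟩ := hf.closed a y (by rw [← hτ]; exact hy)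
  exact ⟨b, rfl⟩

theorem FinQuiver.IsAut.symm {X : Type*} {B : FinQuiver X} {τ : Equiv.Perm X} (hτ : B.IsAut τ) :
    B.IsAut τ.symm := by
  intro i j
  rw [← hτ (τ.symm i) (τ.symm j), τ.apply_symm_apply, τ.apply_symm_apply]

/-- The double cover may be disconnected, but the points lying on charts are stable under adjacency
and under the swap. The swap takes `inl i` to `inr i`, so the question descends to the connected
quiver `Q`. -/
theorem exists_chart_through (hconn : Q.IsConnected) (hop : Q.op = Q.twist σ)
    {W : Type*} {H : FinQuiver W} [Nonempty W] {f : W → V ⊕ V} (hf : IsChart H Q.doubleCover f)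
    (x : V ⊕ V) : ∃ g, IsChart H Q.doubleCover g ∧ x ∈ Set.range g := by
  set p : V ⊕ V → Prop := fun x => ∃ g, IsChart H Q.doubleCover g ∧ x ∈ Set.range g
  have haut : ∀ {τ : Equiv.Perm (V ⊕ V)}, Q.doubleCover.IsAut τ → ∀ x, p x → p (τ x) := by
    rintro τ hτ _ ⟨g, hg, a, rfl⟩
    exact ⟨_, hg.comp_aut hτ, a, rfl⟩
  have hτ : Q.doubleCover.IsAut (swapVia σ) := doubleCover_swapVia hop
  have hlr : ∀ i, p (Sum.inl i) ↔ p (Sum.inr i) := fun i =>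
    ⟨haut hτ (Sum.inl i), fun h => by simpa [swapVia] using haut hτ.symm _ h⟩
  have hadj : ∀ x y, Q.doubleCover x y ≠ 0 → p x → p y := by
    rintro _ y hxy ⟨g, hg, a, rfl⟩
    exact ⟨g, hg, hg.closed a y hxy⟩
  have hall : ∀ i, p (Sum.inl i) := by
    refine hconn.forall_of_exists (fun i j hij => ?_) ?_
    · have h : Q.doubleCover (Sum.inl i) (Sum.inr j) ≠ 0 := hij
      rw [hlr j]
      exact ⟨hadj _ _ h, hadj _ _ (by rwa [doubleCover_symm])⟩
    · obtain ⟨a⟩ := ‹Nonempty W›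
      rcases h : f a with i | i
      · exact ⟨i, f, hf, a, h⟩
      · exact ⟨i, (hlr i).2 ⟨f, hf, a, h⟩⟩
  rcases x with i | i
  · exact hall i
  · exact (hlr i).1 (hall i)

end Cover

/-! ### Decomposition into copies of one component -/

section Components

variable {X W : Type*} {B : FinQuiver X} {H : FinQuiver W}

theorem IsChart.reachable (hH : IsRooted H) {f : W → X} (hf : IsChart H B f) (a b : W) :
    (SimpleGraph.fromRel fun i j => B i j ≠ 0).Reachable (f a) (f b) := by
  obtain ⟨r, g, hg⟩ := hH
  have key : ∀ n a, g a = n → (SimpleGraph.fromRel fun i j => B i j ≠ 0).Reachable (f a) (f r) := by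
    intro n
    induction n using Nat.strong_induction_on with
    | _ n ih =>
      rintro a rfl
      rcases hg a with rfl | ⟨b, hb, hab⟩
      · exact .rfl
      · refine SimpleGraph.Reachable.trans (SimpleGraph.Adj.reachable ?_) (ih _ hb b rfl)
        rw [SimpleGraph.fromRel_adj]
        refine ⟨hf.injective.ne ?_, Or.inl (by rwa [hf.map_eq])⟩
        rintro rfl
        exact lt_irrefl _ hb
  exact (key _ a rfl).trans (key _ b rfl).symm

theorem IsChart.mem_range_of_reachable (hB : ∀ x y, B x y = B y x) {f : W → X}
    (hf : IsChart H B f) {x y : X} (hx : x ∈ Set.range f)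
    (h : (SimpleGraph.fromRel fun i j => B i j ≠ 0).Reachable x y) : y ∈ Set.range f := by
  obtain ⟨w⟩ := h
  induction w with
  | nil => exact hx
  | cons hadj _ ih =>
    refine ih ?_
    rw [SimpleGraph.fromRel_adj] at hadj
    obtain ⟨a, rfl⟩ := hx
    refine hf.closed a _ ?_
    rcases hadj.2 with h | h
    · exact h
    · rwa [hB]

/-- A chart of a rooted `H` fills exactly one connected component: rootedness connects its image,
closedness keeps paths inside. One chart per component gives the bijection. -/
theorem exists_equiv_copies [Finite X] (hB : ∀ x y, B x y = B y x) (hH : IsRooted H)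
    (hcover : ∀ x, ∃ f, IsChart H B f ∧ x ∈ Set.range f) :
    ∃ (k : ℕ) (e : X ≃ W × Fin k), ∀ x y, H.copies k (e x) (e y) = B x y := by
  classical
  set G := SimpleGraph.fromRel fun i j => B i j ≠ 0
  obtain ⟨k, ⟨ε⟩⟩ := Finite.exists_equiv_fin G.ConnectedComponent
  choose rep hrep using fun C : G.ConnectedComponent => C.exists_rep
  choose f hf hmem using fun C => hcover (rep C)
  have hcomp : ∀ C a, G.connectedComponentMk (f C a) = C := by
    intro C a
    obtain ⟨b, hb⟩ := hmem C
    have h := (hf C).reachable hH a b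
    rw [hb] at h
    exact (SimpleGraph.ConnectedComponent.sound h).trans (hrep C)
  let φ : W × Fin k → X := fun z => f (ε.symm z.2) z.1
  have hφ : Function.Bijective φ := by
    constructor
    · rintro ⟨a, c⟩ ⟨b, d⟩ h
      have hcd : ε.symm c = ε.symm d := by
        rw [← hcomp (ε.symm c) a, ← hcomp (ε.symm d) b]
        exact congrArg _ h
      obtain rfl := ε.symm.injective hcd
      exact congrArg (·, c) ((hf _).injective h)
    · intro x
      have hr : G.Reachable (rep (G.connectedComponentMk x)) x :=
        SimpleGraph.ConnectedComponent.exact (hrep (G.connectedComponentMk x))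
      obtain ⟨a, ha⟩ := (hf _).mem_range_of_reachable hB (hmem (G.connectedComponentMk x)) hr
      exact ⟨(a, ε (G.connectedComponentMk x)), by simpa [φ] using ha⟩
  have hmain : ∀ z z', H.copies k z z' = B (φ z) (φ z') := by
    rintro ⟨a, c⟩ ⟨b, d⟩
    simp only [FinQuiver.copies, Matrix.blockDiagonal_apply]
    split_ifs with hcd
    · obtain rfl := hcd
      exact ((hf _).map_eq a b).symm
    · by_contra hne
      obtain ⟨b', hb'⟩ := (hf (ε.symm c)).closed a (φ (b, d)) (Ne.symm hne)
      have h := congrArg G.connectedComponentMk hb'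
      rw [hcomp, hcomp] at h
      exact hcd (ε.symm.injective h)
  refine ⟨k, (Equiv.ofBijective φ hφ).symm, fun x y => ?_⟩
  rw [hmain]
  exact congrArg₂ B ((Equiv.ofBijective φ hφ).apply_symm_apply x)
    ((Equiv.ofBijective φ hφ).apply_symm_apply y)

end Components

end Pretzel

theorem proposition2p7 {V : Type*} [Fintype V] [DecidableEq V]
    (Q : Pretzel.FinQuiver V) (hconn : Q.IsConnected)
    (hop : ∃ σ : Equiv.Perm V, Q.IsAut σ ∧ Q.op = Q.twist σ)
    (hρ : Q.specRadius = 2) :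
    ∃ (m : ℕ) (G : Pretzel.FinQuiver (Fin m)), G.IsTildeADE ∧ Q.IsPretzelizationOf G := by
  obtain ⟨σ, -, hop⟩ := hop
  have := hconn.nonempty
  obtain ⟨u, hu⟩ := Pretzel.isHarmonic_doubleCover hconn (Pretzel.transpose_mul_comm hop) hρ
  obtain ⟨m, H, f, hADE, hgraph, hroot, hf⟩ :=
    Pretzel.hasTildeADEChart hu (Pretzel.doubleCover_symm Q) (Pretzel.doubleCover_self Q)
  have : Nonempty (Fin m) := ⟨hroot.choose⟩
  obtain ⟨k, e, he⟩ := Pretzel.exists_equiv_copies (Pretzel.doubleCover_symm Q) hroot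
    (Pretzel.exists_chart_through hconn hop hf)
  have hτ : Q.doubleCover.IsAut (Pretzel.swapVia σ).symm :=
    Pretzel.FinQuiver.IsAut.symm (Pretzel.doubleCover_swapVia hop)
  -- The automorphism of the copies is the inverse swap conjugated by `e`; twisting by the inverse
  -- undoes the swap in `union_swapVia`.
  refine ⟨m, H, hADE, hgraph, k, (e.symm.trans (Pretzel.swapVia σ).symm).trans e, ?_, e, ?_⟩
  · intro z z'
    obtain ⟨x, rfl⟩ := e.surjective z
    obtain ⟨y, rfl⟩ := e.surjective z'
    simp only [Equiv.trans_apply, Equiv.symm_apply_apply, he]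
    exact hτ x y
  · intro x y
    simp only [Pretzel.FinQuiver.twist, Equiv.trans_apply, Equiv.symm_apply_apply, he]
    rw [← Pretzel.union_swapVia hop, Equiv.apply_symm_apply]
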